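/- An arena is a finite directed graph $G=(V,E)$ (parallel edges and loops allowed) in which every vertex has at least one outgoing edge, together with a partition $V=V_{\mathrm{Max}}\sqcup V_{\mathrm{Min}}$ of its vertices. For weights $w\in\mathbb{R}^E$, the mean payoff game on $(G,w)$ is played by moving a pebble from a start vertex along edges forever; the player who controls the current vertex chooses the outgoing edge. The outcome of the resulting sequence of edges $\pi=(e_1,e_2,\dots)$ is $O(\pi)=\limsup_{t\to\infty}\frac1t\sum_{i=1}^t w(e_i)$, which Max wants to maximize and Min wants to minimize. A (positional) strategy of a player assigns an outgoing edge to every vertex controlled by that player; $\pi(\sigma,\tau,v)$ denotes the play from $v$ under the strategies $\sigma$ of Max and $\tau$ of Min. The value of the game is the unique function $\mathrm{val}(w)\colon V\to\mathbb{R}$, $i\mapsto \mathrm{val}_i(w)$, for which there are strategies $\sigma^*,\tau^*$ with $$O(\pi(\sigma,\tau^*,v))\le \mathrm{val}_v(w)\le O(\pi(\sigma^*,\tau,v))\quad\text{for all } v\in V \text{ and all strategies } \sigma,\tau.$$ For $U\subseteq V$ let $$\mathcal{Z}(U)=\{w\in\mathbb{R}^E : \mathrm{val}_i(w)\ge 0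 \text{ for } i\in U,\ \mathrm{val}_i(w)<0 \text{ for } i\notin U\}.$$ A set $S\subseteq\mathbb{R}^E$ is star-convex if it has a center, that is, a point $x_0\in S$ such that for every $y\in S$ the line segment from $x_0$ to $y$ is contained in $S$. **Proposition.** For every arena $G=(V,E)$ and every $U\subseteq V$: if $\mathcal{Z}(U)$ is nonempty, then it is star-convex. Moreover, it then has a center with entries in $\{-1,1\}$, namely the vector $z\in\mathbb{R}^E$ with $z_e=1$ if the edge $e$ starts at a vertex of $U$, and $z_e=-1$ otherwise. -/

import Mathlib

open Filter

noncomputable section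

/-- An arena on the vertex set `V` with edge set `E`: a directed graph (parallel edges and loops
are allowed) whose vertices are split into those controlled by Max (`vMax`) and those controlled
by Min (the complement), such that every vertex has an outgoing edge. -/
structure Arena (V : Type*) (E : Type*) where
  src : E → V
  tgt : E → V
  vMax : Set V
  exists_out : ∀ v : V, ∃ e : E, src e = v

namespace Arena

/-- The set of vertices controlled by Min. -/
def vMin {V E : Type*} (G : Arena V E) : Set V := G.vMaxᶜ

/-- A positional strategy of Max: an outgoing edge for each vertex controlled by Max. -/
def MaxStrategy {V E : Type*} (G : Arena V E) : Type _ :=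
  {σ : G.vMax → E // ∀ v : G.vMax, G.src (σ v) = v}

/-- A positional strategy of Min: an outgoing edge for each vertex controlled by Min. -/
def MinStrategy {V E : Type*} (G : Arena V E) : Type _ :=
  {τ : G.vMin → E // ∀ v : G.vMin, G.src (τ v) = v}

open scoped Classical in
/-- The edge along which the pebble is moved from `v` if the players use `σ` and `τ`. -/
def move {V E : Type*} (G : Arena V E) (σ : G.MaxStrategy) (τ : G.MinStrategy) (v : V) : E :=
  if h : v ∈ G.vMax then σ.1 ⟨v, h⟩ else τ.1 ⟨v, h⟩

/-- The position of the pebble after `t` moves, starting at `v₀`. -/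
def position {V E : Type*} (G : Arena V E) (σ : G.MaxStrategy) (τ : G.MinStrategy) (v₀ : V) :
    ℕ → V
  | 0 => v₀
  | t + 1 => G.tgt (G.move σ τ (G.position σ τ v₀ t))

/-- The play `π(σ, τ, v₀)`: the infinite sequence of edges traversed by the pebble.
(The sequence is indexed from `0`.) -/
def play {V E : Type*} (G : Arena V E) (σ : G.MaxStrategy) (τ : G.MinStrategy) (v₀ : V)
    (t : ℕ) : E :=
  G.move σ τ (G.position σ τ v₀ t)

end Arena

/-- The mean payoff outcome of an infinite sequence of edges: the upper limit of the average
weights of its initial segments. (For finite `E` the averages are bounded.) -/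
def meanPayoff {E : Type*} (w : E → ℝ) (π : ℕ → E) : ℝ :=
  limsup (fun t : ℕ => (1 / (t : ℝ)) * ∑ i ∈ Finset.range t, w (π i)) atTop

namespace Arena

/-- `val` is the value function of the mean payoff game on `(G, w)`: there are optimal
strategies `σ'` of Max and `τ'` of Min which, from every start vertex, guarantee an outcome
at least, respectively at most, `val`. -/
def IsValue {V E : Type*} (G : Arena V E) (w : E → ℝ) (val : V → ℝ) : Prop :=
  ∃ (σ' : G.MaxStrategy) (τ' : G.MinStrategy),
    ∀ (v₀ : V) (σ : G.MaxStrategy) (τ : G.MinStrategy),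
      meanPayoff w (G.play σ τ' v₀) ≤ val v₀ ∧ val v₀ ≤ meanPayoff w (G.play σ' τ v₀)

/-- The value function of a mean payoff game is unique. -/
theorem IsValue.unique {V E : Type*} {G : Arena V E} {w : E → ℝ} {f g : V → ℝ}
    (hf : G.IsValue w f) (hg : G.IsValue w g) : f = g := by
  obtain ⟨σ₁, τ₁, h₁⟩ := hf
  obtain ⟨σ₂, τ₂, h₂⟩ := hg
  funext v
  exact le_antisymm ((h₁ v σ₁ τ₂).2.trans (h₂ v σ₁ τ₂).1)
    ((h₂ v σ₂ τ₁).2.trans (h₁ v σ₂ τ₁).1)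

/-- `Z(U)`: the weight vectors for which the set of vertices with nonnegative value is
exactly `U`. -/
def region {V E : Type*} (G : Arena V E) (U : Set V) : Set (E → ℝ) :=
  {w | ∃ val : V → ℝ, G.IsValue w val ∧ (∀ i ∈ U, 0 ≤ val i) ∧ (∀ i ∉ U, val i < 0)}

end Arena

/-- `c` is a center of `S`: it lies in `S`, and `S` contains the line segment from `c` to each
of its points. -/
def IsCenter {E : Type*} (S : Set (E → ℝ)) (c : E → ℝ) : Prop :=
  c ∈ S ∧ ∀ y ∈ S, segment ℝ c y ⊆ S

/-- A set is star-convex if it has a center. -/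
def IsStarConvex {E : Type*} (S : Set (E → ℝ)) : Prop :=
  ∃ c, IsCenter S c

end

open Filter Topology

/-! Fix optimal strategies `σ`, `τ` for a point `w` of the region. The value of `w` is constant
along their common play, and no deviation by Min (Max) can lower (raise) it against `σ` (`τ`). So
`σ` traps plays from `U` inside `U`, and `τ` traps the others outside. On a trapped play the weight
`a • z + b • w` is `±a + b * w`, so its outcome is `±a` plus `b` times that of `w` and has the
required sign. Thus `σ` and `τ` certify the signs on the whole segment (`IsOptimal.le_val_position`,
`IsOptimal.val_position_le`).

Membership also needs a value to exist at each such point. This determinacy (`exists_isValue`) comes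
from vanishing discount: discounted games have positional optimal strategies by Banach's fixed point
theorem, some pair recurs as the discount tends to zero, and normalized discounted values bound mean
payoffs up to `O(δ)`. -/

/-! ### Limits of averages -/

/-- The average of the first `t` weights along a sequence of edges. -/
noncomputable def average {E : Type*} (w : E → ℝ) (π : ℕ → E) (t : ℕ) : ℝ :=
  (1 / (t : ℝ)) * ∑ i ∈ Finset.range t, w (π i)

theorem meanPayoff_eq {E : Type*} (w : E → ℝ) (π : ℕ → E) :
    meanPayoff w π = limsup (average w π) atTop := rfl

theorem exists_abs_le_of_finite {E : Type*} [Finite E] (w : E → ℝ) :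
    ∃ W : ℝ, 0 ≤ W ∧ ∀ e, |w e| ≤ W := by
  obtain ⟨W, hW⟩ := (Set.finite_range fun e => |w e|).bddAbove
  exact ⟨max W 0, le_max_right _ _, fun e => (hW ⟨e, rfl⟩).trans (le_max_left _ _)⟩

theorem abs_sum_range_le {a : ℕ → ℝ} {W : ℝ} (h : ∀ t, |a t| ≤ W) (n : ℕ) :
    |∑ i ∈ Finset.range n, a i| ≤ n * W := by
  refine (Finset.abs_sum_le_sum_abs _ _).trans ?_
  simpa using Finset.sum_le_sum (s := Finset.range n) fun i _ => h i

theorem abs_average_le {E : Type*} {w : E → ℝ} {W : ℝ} (hW : ∀ e, |w e| ≤ W)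
    (π : ℕ → E) (t : ℕ) : |average w π t| ≤ W := by
  have h := abs_sum_range_le (fun i => hW (π i)) t
  have h0 : 0 ≤ W := (abs_nonneg _).trans (hW (π 0))
  rcases Nat.eq_zero_or_pos t with rfl | ht
  · simpa [average] using h0
  · have ht' : (0 : ℝ) < t := by exact_mod_cast ht
    rw [average, abs_mul, abs_of_pos (by positivity), one_div, inv_mul_le_iff₀ ht']
    exact h

theorem average_isBoundedUnder_le {E : Type*} [Finite E] (w : E → ℝ) (π : ℕ → E) :
    IsBoundedUnder (· ≤ ·) atTop (average w π) := by
  obtain ⟨W, -, hW⟩ := exists_abs_le_of_finite w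
  exact isBoundedUnder_of ⟨W, fun t => (abs_le.1 (abs_average_le hW π t)).2⟩

theorem average_isBoundedUnder_ge {E : Type*} [Finite E] (w : E → ℝ) (π : ℕ → E) :
    IsBoundedUnder (· ≥ ·) atTop (average w π) := by
  obtain ⟨W, -, hW⟩ := exists_abs_le_of_finite w
  exact isBoundedUnder_of ⟨-W, fun t => (abs_le.1 (abs_average_le hW π t)).1⟩

theorem limsup_le_limsup_of_tendsto_sub {u v : ℕ → ℝ}
    (hu : IsBoundedUnder (· ≥ ·) atTop u) (hv : IsBoundedUnder (· ≤ ·) atTop v)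
    (h : Tendsto (fun t => u t - v t) atTop (𝓝 0)) :
    limsup u atTop ≤ limsup v atTop := by
  refine le_of_forall_pos_le_add fun ε hε => ?_
  have hlt : limsup v atTop < limsup v atTop + ε / 2 := by linarith
  refine limsup_le_of_le hu.isCoboundedUnder_le ?_
  filter_upwards [eventually_lt_of_limsup_lt hlt hv, h.eventually_lt_const (half_pos hε)]
    with t h₁ h₂
  linarith

theorem le_meanPayoff_of_mul_le {E : Type*} [Finite E] {w : E → ℝ} {π : ℕ → E} {c C : ℝ}
    (h : ∀ n : ℕ, n * c ≤ ∑ i ∈ Finset.range n, w (π i) + C) : c ≤ meanPayoff w π := by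
  refine le_of_forall_pos_le_add fun ε hε => ?_
  suffices c - ε ≤ meanPayoff w π by linarith
  refine le_limsup_of_frequently_le (Eventually.frequently ?_) (average_isBoundedUnder_le w π)
  filter_upwards [(tendsto_const_div_atTop_nhds_zero_nat C).eventually_lt_const hε,
    eventually_gt_atTop 0] with n hn hpos
  have hn' : (0 : ℝ) < n := by exact_mod_cast hpos
  have h' := h n
  rw [div_lt_iff₀ hn'] at hn
  rw [one_div, ← div_eq_inv_mul, le_div_iff₀ hn']
  linarith

theorem meanPayoff_le_of_le_mul {E : Type*} [Finite E] {w : E → ℝ} {π : ℕ → E} {c C : ℝ}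
    (h : ∀ n : ℕ, ∑ i ∈ Finset.range n, w (π i) ≤ n * c + C) : meanPayoff w π ≤ c := by
  refine le_of_forall_pos_le_add fun ε hε => ?_
  refine limsup_le_of_le (average_isBoundedUnder_ge w π).isCoboundedUnder_le ?_
  filter_upwards [(tendsto_const_div_atTop_nhds_zero_nat C).eventually_lt_const hε,
    eventually_gt_atTop 0] with n hn hpos
  have hn' : (0 : ℝ) < n := by exact_mod_cast hpos
  have h' := h n
  rw [div_lt_iff₀ hn'] at hn
  rw [one_div, ← div_eq_inv_mul, div_le_iff₀ hn']
  linarith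

theorem tendsto_average_succ_sub {E : Type*} [Finite E] (w : E → ℝ) (π : ℕ → E) :
    Tendsto (fun t => average w π (t + 1) - average w (fun i => π (i + 1)) t) atTop (𝓝 0) := by
  obtain ⟨W, hW0, hW⟩ := exists_abs_le_of_finite w
  refine squeeze_zero_norm' ?_
    ((tendsto_const_div_atTop_nhds_zero_nat (2 * W)).comp (tendsto_add_atTop_nat 1))
  filter_upwards [eventually_gt_atTop 0] with t ht
  have ht' : (0 : ℝ) < t := by exact_mod_cast ht
  have hA := abs_average_le hW (fun i => π (i + 1)) t
  have h0 := hW (π 0)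
  have key : average w π (t + 1) - average w (fun i => π (i + 1)) t =
      (w (π 0) - average w (fun i => π (i + 1)) t) / (t + 1) := by
    simp only [average, Finset.sum_range_succ' _ t]
    push_cast
    field_simp
    ring
  rw [key, Real.norm_eq_abs, abs_div, abs_of_pos (by positivity : (0 : ℝ) < t + 1)]
  simp only [Function.comp_apply, Nat.cast_add, Nat.cast_one]
  gcongr
  calc _ ≤ |w (π 0)| + |average w (fun i => π (i + 1)) t| := abs_sub _ _
    _ ≤ 2 * W := by linarith

/-- The mean payoff does not depend on the first edge. -/
theorem meanPayoff_shift {E : Type*} [Finite E] (w : E → ℝ) (π : ℕ → E) :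
    meanPayoff w (fun i => π (i + 1)) = meanPayoff w π := by
  have hle : IsBoundedUnder (· ≤ ·) atTop fun t => average w π (t + 1) := by
    obtain ⟨W, -, hW⟩ := exists_abs_le_of_finite w
    exact isBoundedUnder_of ⟨W, fun t => (abs_le.1 (abs_average_le hW π (t + 1))).2⟩
  have hge : IsBoundedUnder (· ≥ ·) atTop fun t => average w π (t + 1) := by
    obtain ⟨W, -, hW⟩ := exists_abs_le_of_finite w
    exact isBoundedUnder_of ⟨-W, fun t => (abs_le.1 (abs_average_le hW π (t + 1))).1⟩
  have h := tendsto_average_succ_sub w π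
  rw [meanPayoff_eq, meanPayoff_eq, ← limsup_nat_add (average w π) 1]
  refine le_antisymm ?_ ?_
  · refine limsup_le_limsup_of_tendsto_sub (average_isBoundedUnder_ge _ _) hle ?_
    simpa using h.neg
  · exact limsup_le_limsup_of_tendsto_sub hge (average_isBoundedUnder_le _ _) h

theorem meanPayoff_affine {E : Type*} [Finite E] {w w' : E → ℝ} {π : ℕ → E} {a b : ℝ}
    (hb : 0 ≤ b) (h : ∀ i, w' (π i) = a + b * w (π i)) :
    meanPayoff w' π = a + b * meanPayoff w π := by
  have hmono : Monotone fun x : ℝ => a + b * x := fun x y hxy => by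
    dsimp only; gcongr
  have hcont : Continuous fun x : ℝ => a + b * x := by fun_prop
  rw [meanPayoff_eq, meanPayoff_eq,
    hmono.map_limsup_of_continuousAt (average w π) hcont.continuousAt
      (average_isBoundedUnder_le w π) (average_isBoundedUnder_ge w π).isCoboundedUnder_le]
  refine limsup_congr ?_
  filter_upwards [eventually_gt_atTop 0] with t ht
  have ht' : (0 : ℝ) < t := by exact_mod_cast ht
  simp only [average, Function.comp_apply, h, Finset.sum_add_distrib, Finset.sum_const,
    Finset.card_range, nsmul_eq_mul, ← Finset.mul_sum]
  field_simp

/-! ### Discounted sequences -/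

/-- A function on a finite set satisfying a discounted inequality along a sequence is bounded by
the averages of the weights, up to an error that is linear in the discount `δ`. -/
theorem mul_le_sum_of_discounted {V : Type*} {p : ℕ → V} {K : ℕ} (hK : ∀ t, ∃ s < K, p s = p t)
    {a : ℕ → ℝ} {W δ : ℝ} (hW : 0 ≤ W) (ha : ∀ t, |a t| ≤ W) (hδ : 0 < δ) (hδ1 : δ < 1) {y : V → ℝ}
    (hy : ∀ v, |y v| ≤ W) (h : ∀ t, y (p t) ≤ δ * a t + (1 - δ) * y (p (t + 1))) (n : ℕ) :
    n * (y (p 0) - δ * (2 * W * K)) ≤ ∑ i ∈ Finset.range n, a i + 2 * W / δ := by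
  -- Since `a` and `y` are bounded by `W`, each move loses at most `δ * (2 * W)`.
  have step : ∀ t : ℕ, y (p 0) ≤ y (p t) + δ * (2 * W * t) := by
    intro t
    induction t with
    | zero => simp
    | succ t ih =>
      have h1 : δ * (a t - y (p (t + 1))) ≤ δ * (2 * W) := by
        have := (abs_le.1 (ha t)).2
        have := (abs_le.1 (hy (p (t + 1)))).1
        gcongr
        linarith
      have := h t
      push_cast
      linarith
  -- Every position already occurs before time `K`, so the loss does not grow with `t`.
  have far : ∀ t : ℕ, y (p 0) - δ * (2 * W * K) ≤ y (p t) := by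
    intro t
    obtain ⟨s, hs, hst⟩ := hK t
    have h1 := step s
    rw [hst] at h1
    have hs' : (s : ℝ) ≤ K := by exact_mod_cast hs.le
    have : δ * (2 * W * s) ≤ δ * (2 * W * K) := by gcongr
    linarith
  have sumy : n * (y (p 0) - δ * (2 * W * K)) ≤ ∑ i ∈ Finset.range n, y (p i) := by
    simpa only [Finset.sum_const, Finset.card_range, nsmul_eq_mul] using
      Finset.sum_le_sum (s := Finset.range n) fun i _ => far i
  -- The hypothesis rearranges to `δ * y (p t) ≤ δ * a t + (1 - δ) * (y (p (t + 1)) - y (p t))`,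
  -- which telescopes.
  have tele : δ * ∑ i ∈ Finset.range n, y (p i) ≤
      δ * ∑ i ∈ Finset.range n, a i + (1 - δ) * (y (p n) - y (p 0)) := by
    rw [← Finset.sum_range_sub (fun i => y (p i)), Finset.mul_sum, Finset.mul_sum, Finset.mul_sum,
      ← Finset.sum_add_distrib]
    refine Finset.sum_le_sum fun i _ => ?_
    have := h i
    linarith
  have bd : (1 - δ) * (y (p n) - y (p 0)) ≤ 2 * W := by
    have h1 := (abs_le.1 (hy (p n))).2
    have h2 := (abs_le.1 (hy (p 0))).1
    calc (1 - δ) * (y (p n) - y (p 0)) ≤ (1 - δ) * (2 * W) :=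
          mul_le_mul_of_nonneg_left (by linarith) (by linarith)
      _ ≤ 2 * W := by nlinarith
  have hdiv : δ * (2 * W / δ) = 2 * W := by field_simp
  refine le_of_mul_le_mul_left ?_ hδ
  have := mul_le_mul_of_nonneg_left sumy hδ.le
  linarith

theorem exists_bound_first_visit {V : Type*} [Finite V] (p : ℕ → V) :
    ∃ K : ℕ, ∀ t, ∃ s < K, p s = p t := by
  choose f hf using fun v : Set.range p => v.2
  obtain ⟨K, hK⟩ := (Set.finite_range f).bddAbove
  exact ⟨K + 1, fun t => ⟨f ⟨p t, t, rfl⟩, Nat.lt_succ_of_le (hK ⟨_, rfl⟩), hf ⟨p t, t, rfl⟩⟩⟩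

/-! ### Plays of positional strategies -/

namespace Arena

variable {V E : Type*}

instance [Finite V] [Finite E] (G : Arena V E) : Finite G.MaxStrategy :=
  inferInstanceAs (Finite {σ : G.vMax → E // ∀ v : G.vMax, G.src (σ v) = v})

instance [Finite V] [Finite E] (G : Arena V E) : Finite G.MinStrategy :=
  inferInstanceAs (Finite {τ : G.vMin → E // ∀ v : G.vMin, G.src (τ v) = v})

theorem src_move (G : Arena V E) (σ : G.MaxStrategy) (τ : G.MinStrategy) (v : V) :
    G.src (G.move σ τ v) = v := by
  unfold move
  split
  · exact σ.2 _
  · exact τ.2 ⟨v, ‹_›⟩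

theorem move_of_mem (G : Arena V E) (σ : G.MaxStrategy) (τ : G.MinStrategy) {v : V}
    (h : v ∈ G.vMax) : G.move σ τ v = σ.1 ⟨v, h⟩ := dif_pos h

theorem move_of_notMem (G : Arena V E) (σ : G.MaxStrategy) (τ : G.MinStrategy) {v : V}
    (h : v ∉ G.vMax) : G.move σ τ v = τ.1 ⟨v, h⟩ := dif_neg h

theorem src_play (G : Arena V E) (σ : G.MaxStrategy) (τ : G.MinStrategy) (v : V) (t : ℕ) :
    G.src (G.play σ τ v t) = G.position σ τ v t := G.src_move σ τ _

theorem position_tgt_move (G : Arena V E) (σ : G.MaxStrategy) (τ : G.MinStrategy) (v : V)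
    (t : ℕ) : G.position σ τ (G.tgt (G.move σ τ v)) t = G.position σ τ v (t + 1) := by
  induction t with
  | zero => rfl
  | succ t ih => rw [position, ih, ← position]

theorem meanPayoff_tgt_move [Finite E] (G : Arena V E) (w : E → ℝ) (σ : G.MaxStrategy)
    (τ : G.MinStrategy) (v : V) :
    meanPayoff w (G.play σ τ (G.tgt (G.move σ τ v))) = meanPayoff w (G.play σ τ v) := by
  rw [← meanPayoff_shift w (G.play σ τ v)]
  congr 1
  funext t
  simp only [play, position_tgt_move]

/-! ### Determinacy -/

/-- The value of an edge in the one-step game with continuation payoff `x`. -/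
noncomputable def edgeValue (G : Arena V E) (w : E → ℝ) (β : ℝ) (x : V → ℝ) (e : E) : ℝ :=
  w e + β * x (G.tgt e)

open scoped Classical in
/-- The Shapley operator of the game with discount factor `β`. -/
noncomputable def shapley (G : Arena V E) (w : E → ℝ) (β : ℝ) (x : V → ℝ) (v : V) : ℝ :=
  if v ∈ G.vMax then ⨆ e : {e : E // G.src e = v}, G.edgeValue w β x e
  else ⨅ e : {e : E // G.src e = v}, G.edgeValue w β x e

/-- Monotonicity together with the scaling of constants by `β`; used in both directions, it makes
the operator a sup-norm contraction. -/
theorem shapley_le_add [Finite E] (G : Arena V E) (w : E → ℝ) {β c : ℝ} (hβ : 0 ≤ β)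
    {x y : V → ℝ} (h : ∀ v, x v ≤ y v + c) (v : V) :
    G.shapley w β x v ≤ G.shapley w β y v + β * c := by
  have : Nonempty {e : E // G.src e = v} := let ⟨e, he⟩ := G.exists_out v; ⟨e, he⟩
  have he : ∀ e, G.edgeValue w β x e ≤ G.edgeValue w β y e + β * c := fun e => by
    have := mul_le_mul_of_nonneg_left (h (G.tgt e)) hβ
    unfold edgeValue
    linarith
  unfold shapley
  split
  · refine ciSup_le fun e => (he e).trans ?_
    gcongr
    exact le_ciSup (f := fun e : {e : E // G.src e = v} => G.edgeValue w β y e)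
      (Set.finite_range _).bddAbove e
  · rw [← sub_le_iff_le_add]
    refine le_ciInf fun e => sub_le_iff_le_add.2 (le_trans ?_ (he e))
    exact ciInf_le (f := fun e : {e : E // G.src e = v} => G.edgeValue w β x e)
      (Set.finite_range _).bddBelow e

theorem exists_shapley_eq [Finite V] [Finite E] (G : Arena V E) (w : E → ℝ) {β : ℝ}
    (hβ : 0 ≤ β) (hβ1 : β < 1) : ∃ x, G.shapley w β x = x := by
  have := Fintype.ofFinite V
  have hc : ContractingWith ⟨β, hβ⟩ (G.shapley w β) := by
    refine ⟨by exact_mod_cast hβ1, LipschitzWith.of_dist_le_mul fun x y => ?_⟩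
    change _ ≤ β * dist x y
    refine (dist_pi_le_iff (by positivity)).2 fun v => ?_
    have hxy : ∀ u, |x u - y u| ≤ dist x y := fun u => dist_le_pi_dist x y u
    rw [Real.dist_eq, abs_sub_le_iff]
    constructor
    · rw [sub_le_iff_le_add']
      exact G.shapley_le_add w hβ (fun u => by linarith [(abs_le.1 (hxy u)).2]) v
    · rw [sub_le_iff_le_add']
      exact G.shapley_le_add w hβ (fun u => by linarith [(abs_le.1 (hxy u)).1]) v
  exact ⟨_, hc.fixedPoint_isFixedPt⟩

/-- Optimal strategies of the game with discount factor `1 - δ` and normalized value `y`. -/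
def IsDiscountedOptimal (G : Arena V E) (w : E → ℝ) (δ : ℝ) (σ : G.MaxStrategy)
    (τ : G.MinStrategy) (y : V → ℝ) : Prop :=
  (∀ τ' v, y v ≤ δ * w (G.move σ τ' v) + (1 - δ) * y (G.tgt (G.move σ τ' v))) ∧
    ∀ σ' v, δ * w (G.move σ' τ v) + (1 - δ) * y (G.tgt (G.move σ' τ v)) ≤ y v

theorem exists_isDiscountedOptimal [Finite V] [Finite E] (G : Arena V E) (w : E → ℝ) {δ : ℝ}
    (hδ : 0 < δ) (hδ1 : δ < 1) : ∃ σ τ y, G.IsDiscountedOptimal w δ σ τ y := by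
  obtain ⟨x, hx⟩ := G.exists_shapley_eq w (β := 1 - δ) (by linarith) (by linarith)
  have hne : ∀ v, Nonempty {e : E // G.src e = v} := fun v =>
    let ⟨e, he⟩ := G.exists_out v; ⟨e, he⟩
  have hsup : ∀ v ∈ G.vMax,
      x v = ⨆ e : {e : E // G.src e = v}, G.edgeValue w (1 - δ) x e := fun v hv => by
    conv_lhs => rw [← hx]
    exact if_pos hv
  have hinf : ∀ v ∉ G.vMax,
      x v = ⨅ e : {e : E // G.src e = v}, G.edgeValue w (1 - δ) x e := fun v hv => by
    conv_lhs => rw [← hx]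
    exact if_neg hv
  have hle : ∀ v ∈ G.vMax, ∀ e, G.src e = v → G.edgeValue w (1 - δ) x e ≤ x v :=
    fun v hv e he => by
      rw [hsup v hv]
      exact le_ciSup (f := fun e : {e : E // G.src e = v} => G.edgeValue w (1 - δ) x e)
        (Set.finite_range _).bddAbove ⟨e, he⟩
  have hge : ∀ v ∉ G.vMax, ∀ e, G.src e = v → x v ≤ G.edgeValue w (1 - δ) x e :=
    fun v hv e he => by
      rw [hinf v hv]
      exact ciInf_le (f := fun e : {e : E // G.src e = v} => G.edgeValue w (1 - δ) x e)
        (Set.finite_range _).bddBelow ⟨e, he⟩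
  have hσ : ∀ v : G.vMax, ∃ e, G.src e = v ∧ G.edgeValue w (1 - δ) x e = x v := fun v => by
    obtain ⟨e, he⟩ := exists_eq_ciSup_of_finite
      (f := fun e : {e : E // G.src e = v} => G.edgeValue w (1 - δ) x e)
    exact ⟨e, e.2, he.trans (hsup v v.2).symm⟩
  have hτ : ∀ v : G.vMin, ∃ e, G.src e = v ∧ G.edgeValue w (1 - δ) x e = x v := fun v => by
    obtain ⟨e, he⟩ := exists_eq_ciInf_of_finite
      (f := fun e : {e : E // G.src e = v} => G.edgeValue w (1 - δ) x e)
    exact ⟨e, e.2, he.trans (hinf v v.2).symm⟩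
  choose s hs hs' using hσ
  choose r hr hr' using hτ
  obtain ⟨σ₀, hσ₀⟩ : ∃ σ₀ : G.MaxStrategy, ∀ v, G.edgeValue w (1 - δ) x (σ₀.1 v) = x v :=
    ⟨⟨s, hs⟩, hs'⟩
  obtain ⟨τ₀, hτ₀⟩ : ∃ τ₀ : G.MinStrategy, ∀ v, G.edgeValue w (1 - δ) x (τ₀.1 v) = x v :=
    ⟨⟨r, hr⟩, hr'⟩
  have scale : ∀ e, δ * w e + (1 - δ) * (δ * x (G.tgt e)) = δ * G.edgeValue w (1 - δ) x e :=
    fun e => by unfold edgeValue; ring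
  -- The factor `δ` normalizes the fixed point so that its bound is independent of `δ`.
  refine ⟨σ₀, τ₀, fun v => δ * x v, fun τ v => ?_, fun σ v => ?_⟩
  · rw [scale]
    refine mul_le_mul_of_nonneg_left ?_ hδ.le
    by_cases hv : v ∈ G.vMax
    · rw [move_of_mem _ _ _ hv, hσ₀ ⟨v, hv⟩]
    · exact hge v hv _ (G.src_move _ _ v)
  · rw [scale]
    refine mul_le_mul_of_nonneg_left ?_ hδ.le
    by_cases hv : v ∈ G.vMax
    · exact hle v hv _ (G.src_move _ _ v)
    · rw [move_of_notMem _ _ _ hv]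
      exact (hτ₀ ⟨v, hv⟩).le

/-- Maximum principle: where `y` is maximal, `y ≤ δ * W + (1 - δ) * y`; dually at a minimum. -/
theorem IsDiscountedOptimal.abs_le [Finite V] {G : Arena V E} {w : E → ℝ} {δ W : ℝ}
    {σ : G.MaxStrategy} {τ : G.MinStrategy} {y : V → ℝ} (h : G.IsDiscountedOptimal w δ σ τ y)
    (hδ : 0 < δ) (hδ1 : δ < 1) (hW : ∀ e, |w e| ≤ W) (v : V) : |y v| ≤ W := by
  have : Nonempty V := ⟨v⟩
  obtain ⟨a, ha⟩ := Finite.exists_max y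
  obtain ⟨b, hb⟩ := Finite.exists_min y
  have ha1 := mul_le_mul_of_nonneg_left (ha (G.tgt (G.move σ τ a))) (by linarith : 0 ≤ 1 - δ)
  have hb1 := mul_le_mul_of_nonneg_left (hb (G.tgt (G.move σ τ b))) (by linarith : 0 ≤ 1 - δ)
  have ha2 := mul_le_mul_of_nonneg_left (_root_.abs_le.1 (hW (G.move σ τ a))).2 hδ.le
  have hb2 := mul_le_mul_of_nonneg_left (_root_.abs_le.1 (hW (G.move σ τ b))).1 hδ.le
  have ha3 : y a ≤ W := le_of_mul_le_mul_left (by linarith [h.1 τ a]) hδ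
  have hb3 : -W ≤ y b := le_of_mul_le_mul_left (by linarith [h.2 σ b]) hδ
  exact _root_.abs_le.2 ⟨hb3.trans (hb v), (ha v).trans ha3⟩

/-- The point is that `K` depends on the play but not on `δ`, so the error vanishes as `δ` tends to
zero. -/
theorem exists_le_meanPayoff_add [Finite V] [Finite E] (G : Arena V E) (w : E → ℝ)
    (σ : G.MaxStrategy) (τ : G.MinStrategy) (v : V) :
    ∃ K : ℝ, ∀ δ, 0 < δ → δ < 1 → ∀ τ₀ y, G.IsDiscountedOptimal w δ σ τ₀ y →
      y v ≤ meanPayoff w (G.play σ τ v) + δ * K := by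
  obtain ⟨W, hW0, hW⟩ := exists_abs_le_of_finite w
  obtain ⟨K, hK⟩ := exists_bound_first_visit (G.position σ τ v)
  refine ⟨2 * W * K, fun δ hδ hδ1 τ₀ y h => sub_le_iff_le_add.1 ?_⟩
  exact le_meanPayoff_of_mul_le <| mul_le_sum_of_discounted hK hW0 (fun t => hW _) hδ hδ1
    (h.abs_le hδ hδ1 hW) fun t => h.1 τ _

theorem exists_meanPayoff_le_add [Finite V] [Finite E] (G : Arena V E) (w : E → ℝ)
    (σ : G.MaxStrategy) (τ : G.MinStrategy) (v : V) :
    ∃ K : ℝ, ∀ δ, 0 < δ → δ < 1 → ∀ σ₀ y, G.IsDiscountedOptimal w δ σ₀ τ y →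
      meanPayoff w (G.play σ τ v) ≤ y v + δ * K := by
  obtain ⟨W, hW0, hW⟩ := exists_abs_le_of_finite w
  obtain ⟨K, hK⟩ := exists_bound_first_visit (G.position σ τ v)
  refine ⟨2 * W * K, fun δ hδ hδ1 σ₀ y h => ?_⟩
  refine meanPayoff_le_of_le_mul (C := 2 * W / δ) fun n => ?_
  -- Negating weights and values exchanges the roles of the players.
  have key := mul_le_sum_of_discounted (y := fun u => -y u)
    (a := fun t => -w (G.play σ τ v t)) hK hW0 (fun t => by rw [abs_neg]; exact hW _) hδ hδ1
    (fun u => by rw [abs_neg]; exact h.abs_le hδ hδ1 hW u)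
    (fun t => by have := h.2 σ (G.position σ τ v t); simp only [play, position]; linarith) n
  rw [Finset.sum_neg_distrib] at key
  simp only [position] at key
  linarith

/-- Mean payoff games on finite arenas are determined in positional strategies. -/
theorem exists_isValue [Finite V] [Finite E] (G : Arena V E) (w : E → ℝ) :
    ∃ val, G.IsValue w val := by
  have hpos : ∀ n : ℕ, (0 : ℝ) < 1 / ((n : ℝ) + 2) := fun n => by positivity
  have hlt : ∀ n : ℕ, 1 / ((n : ℝ) + 2) < 1 := fun n => by
    rw [div_lt_one (by positivity)]
    have : (0 : ℝ) ≤ n := n.cast_nonneg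
    linarith
  choose s r y h using fun n : ℕ => G.exists_isDiscountedOptimal w (hpos n) (hlt n)
  -- Pigeonhole: there are finitely many strategy pairs, so one is optimal for arbitrarily small
  -- discounts.
  obtain ⟨⟨σ', τ'⟩, hinf⟩ := Finite.exists_infinite_fiber fun n => (s n, r n)
  have hfreq : ∃ᶠ n in atTop, (s n, r n) = (σ', τ') :=
    Nat.frequently_atTop_iff_infinite.2 (Set.infinite_coe_iff.1 hinf)
  have main : ∀ v σ τ, meanPayoff w (G.play σ τ' v) ≤ meanPayoff w (G.play σ' τ v) := by
    intro v σ τ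
    obtain ⟨K₁, hK₁⟩ := G.exists_meanPayoff_le_add w σ τ' v
    obtain ⟨K₂, hK₂⟩ := G.exists_le_meanPayoff_add w σ' τ v
    have hlim : Tendsto (fun n : ℕ => 1 / ((n : ℝ) + 2) * (K₁ + K₂)) atTop (𝓝 0) := by
      have := (tendsto_const_div_atTop_nhds_zero_nat (K₁ + K₂)).comp (tendsto_add_atTop_nat 2)
      refine this.congr fun n => ?_
      simp [div_eq_inv_mul]
    refine le_of_forall_pos_le_add fun ε hε => ?_
    obtain ⟨n, hn, hn'⟩ := (hfreq.and_eventually (hlim.eventually_lt_const hε)).exists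
    obtain ⟨rfl, rfl⟩ := Prod.mk.inj hn
    have h₁ := hK₁ _ (hpos n) (hlt n) _ _ (h n)
    have h₂ := hK₂ _ (hpos n) (hlt n) _ _ (h n)
    linarith
  exact ⟨fun v => meanPayoff w (G.play σ' τ' v), σ', τ', fun v σ τ => ⟨main v σ τ', main v σ' τ⟩⟩

/-! ### Values along plays of optimal strategies -/

/-- The strategies `σ` and `τ` are optimal and `val` is the value they guarantee. -/
def IsOptimal (G : Arena V E) (w : E → ℝ) (val : V → ℝ) (σ' : G.MaxStrategy)
    (τ' : G.MinStrategy) : Prop :=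
  ∀ (v₀ : V) (σ : G.MaxStrategy) (τ : G.MinStrategy),
    meanPayoff w (G.play σ τ' v₀) ≤ val v₀ ∧ val v₀ ≤ meanPayoff w (G.play σ' τ v₀)

/-- A play is not affected by changing the moves at vertices that it does not visit. -/
theorem play_congr (G : Arena V E) {σ σ₂ : G.MaxStrategy} {τ τ₂ : G.MinStrategy} {v : V}
    (h : ∀ t, G.move σ₂ τ₂ (G.position σ τ v t) = G.move σ τ (G.position σ τ v t)) :
    G.play σ₂ τ₂ v = G.play σ τ v := by
  have hpos : ∀ t, G.position σ₂ τ₂ v t = G.position σ τ v t := by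
    intro t
    induction t with
    | zero => rfl
    | succ t ih => simp only [position, ih, h]
  funext t
  simp only [play, hpos, h]

namespace IsOptimal

variable {G : Arena V E} {w : E → ℝ} {val : V → ℝ} {σ : G.MaxStrategy} {τ : G.MinStrategy}

theorem meanPayoff_eq (h : G.IsOptimal w val σ τ) (v : V) :
    meanPayoff w (G.play σ τ v) = val v :=
  le_antisymm (h v σ τ).1 (h v σ τ).2

variable [Finite E]

theorem val_position (h : G.IsOptimal w val σ τ) (v : V) (t : ℕ) :
    val (G.position σ τ v t) = val v := by
  induction t with
  | zero => rfl
  | succ t ih =>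
    rw [position, ← h.meanPayoff_eq, meanPayoff_tgt_move, h.meanPayoff_eq, ih]

theorem val_tgt_move (h : G.IsOptimal w val σ τ) (v : V) :
    val (G.tgt (G.move σ τ v)) = val v := h.val_position v 1

/-- Otherwise Min could take `e` once and then follow `τ`, pushing the outcome against `σ` below the
value at the source. -/
theorem val_src_le (h : G.IsOptimal w val σ τ) {e : E} (he : G.src e ∉ G.vMax) :
    val (G.src e) ≤ val (G.tgt e) := by
  classical
  by_contra! hlt
  let τ₂ : G.MinStrategy := ⟨Function.update τ.1 ⟨G.src e, he⟩ e, fun v => by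
    by_cases hv : v = ⟨G.src e, he⟩
    · subst hv; simp
    · rw [Function.update_of_ne hv]; exact τ.2 v⟩
  have hmove : G.move σ τ₂ (G.src e) = e := by
    rw [move_of_notMem _ _ _ he]; exact Function.update_self ..
  have hplay : G.play σ τ₂ (G.tgt e) = G.play σ τ (G.tgt e) := by
    refine G.play_congr fun t => ?_
    have hne : G.position σ τ (G.tgt e) t ≠ G.src e := fun heq => by
      have := h.val_position (G.tgt e) t
      rw [heq] at this
      linarith
    by_cases hv : G.position σ τ (G.tgt e) t ∈ G.vMax
    · rw [move_of_mem _ _ _ hv, move_of_mem _ _ _ hv]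
    · rw [move_of_notMem _ _ _ hv, move_of_notMem _ _ _ hv]
      exact Function.update_of_ne (fun heq => hne (congrArg Subtype.val heq)) _ _
  have h1 := (h (G.src e) σ τ₂).2
  rw [← meanPayoff_tgt_move, hmove, hplay, h.meanPayoff_eq] at h1
  linarith

theorem val_tgt_le (h : G.IsOptimal w val σ τ) {e : E} (he : G.src e ∈ G.vMax) :
    val (G.tgt e) ≤ val (G.src e) := by
  classical
  by_contra! hlt
  let σ₂ : G.MaxStrategy := ⟨Function.update σ.1 ⟨G.src e, he⟩ e, fun v => by
    by_cases hv : v = ⟨G.src e, he⟩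
    · subst hv; simp
    · rw [Function.update_of_ne hv]; exact σ.2 v⟩
  have hmove : G.move σ₂ τ (G.src e) = e := by
    rw [move_of_mem _ _ _ he]; exact Function.update_self ..
  have hplay : G.play σ₂ τ (G.tgt e) = G.play σ τ (G.tgt e) := by
    refine G.play_congr fun t => ?_
    have hne : G.position σ τ (G.tgt e) t ≠ G.src e := fun heq => by
      have := h.val_position (G.tgt e) t
      rw [heq] at this
      linarith
    by_cases hv : G.position σ τ (G.tgt e) t ∈ G.vMax
    · rw [move_of_mem _ _ _ hv, move_of_mem _ _ _ hv]
      exact Function.update_of_ne (fun heq => hne (congrArg Subtype.val heq)) _ _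
    · rw [move_of_notMem _ _ _ hv, move_of_notMem _ _ _ hv]
  have h1 := (h (G.src e) σ₂ τ).1
  rw [← meanPayoff_tgt_move, hmove, hplay, h.meanPayoff_eq] at h1
  linarith

/-- The value does not decrease along a play in which Max uses an optimal strategy. -/
theorem le_val_position (h : G.IsOptimal w val σ τ) (τ₂ : G.MinStrategy) (v : V) (t : ℕ) :
    val v ≤ val (G.position σ τ₂ v t) := by
  induction t with
  | zero => exact le_rfl
  | succ t ih =>
    refine ih.trans ?_
    rw [position]
    set u := G.position σ τ₂ v t
    by_cases hu : u ∈ G.vMax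
    -- At a Max vertex the move is that of `σ`, as in the optimal play, so the value is preserved.
    · rw [move_of_mem _ _ _ hu, ← h.val_tgt_move u, move_of_mem _ _ _ hu]
    · have hs := G.src_move σ τ₂ u
      have := h.val_src_le (e := G.move σ τ₂ u) (by rwa [hs])
      rwa [hs] at this

/-- The value does not increase along a play in which Min uses an optimal strategy. -/
theorem val_position_le (h : G.IsOptimal w val σ τ) (σ₂ : G.MaxStrategy) (v : V) (t : ℕ) :
    val (G.position σ₂ τ v t) ≤ val v := by
  induction t with
  | zero => exact le_rfl
  | succ t ih =>
    refine le_trans ?_ ih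
    rw [position]
    set u := G.position σ₂ τ v t
    by_cases hu : u ∈ G.vMax
    · have hs := G.src_move σ₂ τ u
      have := h.val_tgt_le (e := G.move σ₂ τ u) (by rwa [hs])
      rwa [hs] at this
    · rw [move_of_notMem _ _ _ hu, ← h.val_tgt_move u, move_of_notMem _ _ _ hu]

end IsOptimal

/-! ### Star-convexity of the region -/

/-- The weights that are `1` on the edges starting in `U` and `-1` on the other edges. -/
noncomputable def signWeight (G : Arena V E) (U : Set V) (e : E) : ℝ :=
  open scoped Classical in if G.src e ∈ U then 1 else -1

theorem signWeight_of_mem (G : Arena V E) {U : Set V} {e : E} (h : G.src e ∈ U) :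
    G.signWeight U e = 1 := if_pos h

theorem signWeight_of_notMem (G : Arena V E) {U : Set V} {e : E} (h : G.src e ∉ U) :
    G.signWeight U e = -1 := if_neg h

theorem segment_signWeight_subset_region [Finite V] [Finite E] (G : Arena V E) {U : Set V}
    {w : E → ℝ} (hw : w ∈ G.region U) : segment ℝ (G.signWeight U) w ⊆ G.region U := by
  rintro w' ⟨a, b, ha, hb, hab, rfl⟩
  obtain ⟨val, ⟨σ, τ, hopt⟩, hU, hU'⟩ := hw
  have h : G.IsOptimal w val σ τ := hopt
  obtain ⟨val', hval'⟩ := G.exists_isValue (a • G.signWeight U + b • w)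
  obtain ⟨σ', τ', h'⟩ := id hval'
  refine ⟨val', hval', fun v hv => ?_, fun v hv => ?_⟩
  -- The strategy `σ`, optimal for `w`, is tested against `τ'`, optimal for the point of the
  -- segment.
  · refine le_trans ?_ (h' v σ τ').1
    have hmem : ∀ t, G.src (G.play σ τ' v t) ∈ U := fun t => by
      rw [src_play]
      by_contra hc
      have h1 := h.le_val_position τ' v t
      have h2 := hU v hv
      have h3 := hU' _ hc
      linarith
    rw [meanPayoff_affine (w := w) (a := a) hb fun t => by
      simp [G.signWeight_of_mem (hmem t)]]
    have := (hU v hv).trans (h v σ τ').2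
    positivity
  · refine lt_of_le_of_lt (h' v σ' τ).2 ?_
    have hmem : ∀ t, G.src (G.play σ' τ v t) ∉ U := fun t => by
      rw [src_play]
      intro hc
      have h1 := h.val_position_le σ' v t
      have h2 := hU' v hv
      have h3 := hU _ hc
      linarith
    rw [meanPayoff_affine (w := w) (a := -a) hb fun t => by
      simp [G.signWeight_of_notMem (hmem t)]]
    have hneg : meanPayoff w (G.play σ' τ v) < 0 := (h v σ' τ).1.trans_lt (hU' v hv)
    -- If `b = 0`, strictness comes from `a = 1`; otherwise from the negative outcome for `w`.
    rcases hb.eq_or_lt with rfl | hb'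
    · linarith
    · linarith [mul_neg_of_pos_of_neg hb' hneg]

theorem isCenter_signWeight [Finite V] [Finite E] (G : Arena V E) {U : Set V}
    (hne : (G.region U).Nonempty) : IsCenter (G.region U) (G.signWeight U) :=
  let ⟨_, hw⟩ := hne
  ⟨G.segment_signWeight_subset_region hw (left_mem_segment ℝ _ _),
    fun _ hy => G.segment_signWeight_subset_region hy⟩

end Arena

theorem mainTheorem12 {V E : Type*} [Finite V] [Finite E] (G : Arena V E) (U : Set V)
    (hne : (G.region U).Nonempty) :
    IsStarConvex (G.region U) ∧
      ∃ z : E → ℝ, IsCenter (G.region U) z ∧ (∀ e, z e = 1 ∨ z e = -1) ∧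
        (∀ e, G.src e ∈ U → z e = 1) ∧ (∀ e, G.src e ∉ U → z e = -1) := by
  have hc := G.isCenter_signWeight hne
  refine ⟨⟨_, hc⟩, _, hc, fun e => ?_, fun e => G.signWeight_of_mem, fun e => G.signWeight_of_notMem⟩
  by_cases he : G.src e ∈ U
  · exact Or.inl (G.signWeight_of_mem he)
  · exact Or.inr (G.signWeight_of_notMem he)
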